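/- Let $k$ be a field. A $k$-algebra means a $k$-vector space with a bilinear multiplication, not assumed associative or unital; homomorphisms are $k$-linear multiplicative maps. Monomials are bracketed nonempty products of indeterminates $x_0,x_1,x_2,\dots$ (repetitions allowed), and the length of a monomial is its number of letters. The submonomials of a monomial $w$ are $w$ itself and, if $w=w'w''$, the submonomials of $w'$ and of $w''$. A monomial $w$ is $[1,1+d]$-separating if for some $m\in\{1,\dots,1+d\}$ it has a submonomial of length exactly $\mathrm{length}(w)-m$. An identity is homogeneous if all monomials occurring in it have the same number of occurrences of each indeterminate. A variety $\mathbf V$ of $k$-algebras (the class of all $k$-algebras satisfying a given set of identities) is separative if there is a natural number $d\ge 0$ such that for every monomial $w$ of length $>1$, $\mathbf V$ satisfies a homogeneous identity equating $w$ with a $k$-linear combination of $[1,1+d]$-separating monomials. For a $k$-algebra $C$ put $C_{(1)}=C$ and $C_{(n+1)}=\sum_{0<m<n+1}C_{(m)}C_{(n+1-m)}$, where $XY$ denotes the span of all products $xy$ $(x\in X,\ y\in Y)$; $C$ is nilpotent if $C_{(n)}=\{0\}$ for some $n\ge1$. Let $A=\varprojlim_{i\in I}A_i$ be the inverse limit of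 an inverse system of $k$-algebras $A_i$ belonging to a separative variety $\mathbf V$, and let $B=\varprojlim_{j\in J}B_j$ be the inverse limit of an arbitrary inverse system of $k$-algebras (each system being indexed by a preordered set, with algebra homomorphisms as connecting morphisms). Give $A$ and $B$ the inverse limit topologies, that is, the subspace topologies from $\prod_i A_i$ and $\prod_j B_j$ with all $A_i$ and $B_j$ discrete. Suppose that $A$ has a finitely generated dense subalgebra, and that either (1) all $A_i$ are finite-dimensional and all $B_j$ are nilpotent, or (2) all $A_i$ are nilpotent and all $B_j$ are finite-dimensional. Then every $k$-algebra homomorphism $A\to B$ is continuous. -/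

import Mathlib

open scoped Topology

/-! Throughout, a `k`-algebra is a vector space over the field `k` with a bilinear multiplication,
neither unital nor associative in general:
`[NonUnitalNonAssocRing A] [Module k A] [IsScalarTower k A A] [SMulCommClass k A A]`.
Monomials (bracketed nonempty products of indeterminates `x₀, x₁, …`, repetitions allowed) are the
elements of `FreeMagma ℕ`, their length is `FreeMagma.length`, and their linear combinations are
the elements of `FreeNonUnitalNonAssocAlgebra k ℕ`. -/

namespace NAAlg

universe u v w

section Nilpotent

variable (k : Type u) (A : Type v) [Field k] [NonUnitalNonAssocRing A] [Module k A]
  [IsScalarTower k A A] [SMulCommClass k A A]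

/-- The subspaces `A₍ₙ₎`: `A₍₁₎ = A` and `A₍ₙ₊₁₎ = ∑_{0 < m < n+1} A₍ₘ₎ A₍ₙ₊₁₋ₘ₎`, where `B C` is
the span of all products `b * c`.  (The value at `0` is a convention and is never used.)
In the last clause the summation index is `m + 1`, with `0 ≤ m ≤ n`. -/
noncomputable def lowerPower : ℕ → Submodule k A
  | 0 => ⊤
  | 1 => ⊤
  | n + 2 => ⨆ m : Fin (n + 1),
      Submodule.map₂ (LinearMap.mul k A) (lowerPower (m + 1)) (lowerPower (n + 1 - m))
termination_by n => n
decreasing_by all_goals omega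

/-- An algebra is nilpotent if `A₍ₙ₎ = 0` for some `n ≥ 1`. -/
def IsNilpotentAlg : Prop := ∃ n : ℕ, 1 ≤ n ∧ lowerPower k A n = ⊥

end Nilpotent

section Monomials

/-- The indeterminates occurring in a monomial, with multiplicity. -/
def letters : FreeMagma ℕ → Multiset ℕ
  | .of x => {x}
  | .mul a b => letters a + letters b

/-- `IsSubmonomial u t`: every monomial is a submonomial of itself, and the other submonomials of
`t = t' t''` are those of `t'` and those of `t''`. -/
inductive IsSubmonomial : FreeMagma ℕ → FreeMagma ℕ → Prop
  | refl (t : FreeMagma ℕ) : IsSubmonomial t t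
  | left {u a : FreeMagma ℕ} (b : FreeMagma ℕ) : IsSubmonomial u a → IsSubmonomial u (a * b)
  | right {u b : FreeMagma ℕ} (a : FreeMagma ℕ) : IsSubmonomial u b → IsSubmonomial u (a * b)

/-- `t` is `m`-separating: it has a submonomial of length exactly `length t - m`. -/
def IsSeparating (m : ℕ) (t : FreeMagma ℕ) : Prop :=
  ∃ u, IsSubmonomial u t ∧ u.length + m = t.length

/-- `t` is `[n, N]`-separating: it is `m`-separating for some `n ≤ m ≤ N`. -/
def IsIccSeparating (n N : ℕ) (t : FreeMagma ℕ) : Prop :=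
  ∃ m, n ≤ m ∧ m ≤ N ∧ IsSeparating m t

end Monomials

section Varieties

variable (k : Type u) [Field k]

/-- A monomial, as an element of the free nonassociative algebra. -/
noncomputable def mono (t : FreeMagma ℕ) : FreeNonUnitalNonAssocAlgebra k ℕ :=
  MonoidAlgebra.ofMagma k (FreeMagma ℕ) t

variable {k}

/-- `p` is homogeneous: all its monomials have the same number of occurrences of each
indeterminate. -/
def IsHomogeneousPoly (p : FreeNonUnitalNonAssocAlgebra k ℕ) : Prop :=
  ∃ m : Multiset ℕ, p ∈ Submodule.span k (mono k '' {t | letters t = m})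

/-- `A` satisfies the identity `p = 0`. -/
def Satisfies (A : Type v) [NonUnitalNonAssocRing A] [Module k A]
    [IsScalarTower k A A] [SMulCommClass k A A] (p : FreeNonUnitalNonAssocAlgebra k ℕ) : Prop :=
  ∀ x : ℕ → A, FreeNonUnitalNonAssocAlgebra.lift k x p = 0

variable (k) in
/-- A variety of `k`-algebras, presented by a set of defining identities `p = 0`. -/
structure Variety where
  /-- the left-hand sides `p` of the defining identities `p = 0` -/
  defining : Set (FreeNonUnitalNonAssocAlgebra k ℕ)

namespace Variety

/-- `A` belongs to the variety. -/
def Mem (V : Variety k) (A : Type v) [NonUnitalNonAssocRing A] [Module k A]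
    [IsScalarTower k A A] [SMulCommClass k A A] : Prop :=
  ∀ p ∈ V.defining, Satisfies A p

/-- `p = 0` is an identity of the variety: it holds in all algebras of the variety.  (It is enough
to look at algebras in the universe of `k`: a failure of `p = 0` in any algebra of the variety is
also one in a countably generated subalgebra, which is a quotient of the free algebra on `ℕ`.) -/
def IsIdentity (V : Variety k) (p : FreeNonUnitalNonAssocAlgebra k ℕ) : Prop :=
  ∀ (A : Type u) [NonUnitalNonAssocRing A] [Module k A] [IsScalarTower k A A]
    [SMulCommClass k A A], V.Mem A → Satisfies A p

/-- The variety is `[1, 1+d]`-separative: for every monomial `t` of length `> 1` it has a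
homogeneous identity `t = q` with `q` a linear combination of `[1, 1+d]`-separating monomials. -/
def IsIccSeparative (V : Variety k) (d : ℕ) : Prop :=
  ∀ t : FreeMagma ℕ, 1 < t.length →
    ∃ q ∈ Submodule.span k (mono k '' {s | IsIccSeparating 1 (1 + d) s}),
      IsHomogeneousPoly (mono k t - q) ∧ V.IsIdentity (mono k t - q)

/-- The variety is separative: `[1, 1+d]`-separative for some natural number `d`. -/
def IsSeparative (V : Variety k) : Prop := ∃ d : ℕ, V.IsIccSeparative d

end Variety

end Varieties

section InverseLimit

variable {k : Type u} [Field k] {I : Type w} [Preorder I] {A : I → Type v}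
  [∀ i, NonUnitalNonAssocRing (A i)] [∀ i, Module k (A i)]

/-- The inverse limit of a system of algebras `A i` with connecting morphisms
`f h : A j → A i` for `h : i ≤ j`: the algebra of compatible families.  When the `A i` carry the
discrete topology, the topology which it has as a subspace of the product is the inverse limit
topology. -/
def invLimit (f : ∀ ⦃i j : I⦄, i ≤ j → A j →ₙₐ[k] A i) : NonUnitalSubalgebra k (∀ i, A i) where
  carrier := {a | ∀ ⦃i j : I⦄ (h : i ≤ j), f h (a j) = a i}
  add_mem' ha hb i j h := by simp [ha h, hb h]
  zero_mem' i j h := by simp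
  mul_mem' ha hb i j h := by simp [ha h, hb h]
  smul_mem' c a ha i j h := by simp [ha h]

end InverseLimit

end NAAlg

/-! Write A and B for the two limits and A₍ₙ₎ for the lower powers of A. It suffices that each
composite ψ : A → B_j is continuous, and this follows from two facts: every A₍ₙ₎ is open, and ψ
kills some A₍ₙ₎.

Openness uses separativity. A separating monomial arises from a slightly shorter one by
multiplications by short monomials. Iterating, every sufficiently long monomial in the topological
generators lies in a sum of ranges of finitely many operators, each a product of N degree-raising
ones (`lift_mem_iSup_range`); this sum lies in A₍N+1₎. The projections of A have finite-dimensional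
images (in case (2) by nilpotence and density), so A is the full dual of its space `coordDual` of
continuous functionals. Hence such a sum of ranges is closed (`mem_iSup_range_of_forall_dual`).
Together with the span of the short monomials it is dense, so it has finite codimension and is open
(`exists_finset_forall_mem_lowerPower`).

If B_j is nilpotent, ψ kills a lower power because homomorphisms respect lower powers. If B_j is
finite-dimensional and the A_i are nilpotent, geometric series make 1 - T surjective for suitable
degree-raising operators T, so a Nakayama argument (`le_of_le_sup_span_of_surjective_sub`) applies
to the stable image of the lower powers modulo ker ψ (`exists_lowerPower_le_ker`). -/

namespace NAAlg

/-! ### Evaluation of monomials. -/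

section Evaluation

variable {k : Type*} [Field k] {A : Type*} [NonUnitalNonAssocRing A] [Module k A]
  [IsScalarTower k A A] [SMulCommClass k A A]

theorem lift_mono (x : ℕ → A) (t : FreeMagma ℕ) :
    FreeNonUnitalNonAssocAlgebra.lift k x (mono k t) = FreeMagma.lift x t := by
  simp [mono, FreeNonUnitalNonAssocAlgebra.lift]

theorem map_lift {B : Type*} [NonUnitalNonAssocRing B] [Module k B]
    [IsScalarTower k B B] [SMulCommClass k B B] (φ : A →ₙₐ[k] B) (x : ℕ → A)
    (p : FreeNonUnitalNonAssocAlgebra k ℕ) :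
    φ (FreeNonUnitalNonAssocAlgebra.lift k x p) =
      FreeNonUnitalNonAssocAlgebra.lift k (φ ∘ x) p := by
  have h : φ.comp (FreeNonUnitalNonAssocAlgebra.lift k x) =
      FreeNonUnitalNonAssocAlgebra.lift k (φ ∘ x) :=
    FreeNonUnitalNonAssocAlgebra.hom_ext k fun n => by simp
  exact DFunLike.congr_fun h p

theorem length_eq_card_letters (t : FreeMagma ℕ) : t.length = (letters t).card := by
  induction t with
  | ih1 x => simp [letters, FreeMagma.length]
  | ih2 a b ha hb =>
    have h1 : (a * b).length = a.length + b.length := rfl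
    have h2 : letters (a * b) = letters a + letters b := rfl
    rw [h1, h2, Multiset.card_add, ← ha, ← hb]

end Evaluation

/-! ### Identities of a variety and of its members. -/

section Identities

variable {k : Type u} [Field k] {A : Type v} [NonUnitalNonAssocRing A] [Module k A]
  [IsScalarTower k A A] [SMulCommClass k A A]

variable (k A) in
/-- The congruence of the free algebra given by the identities of `A`. -/
def identityCon : RingCon (FreeNonUnitalNonAssocAlgebra k ℕ) where
  r p q := ∀ x : ℕ → A, FreeNonUnitalNonAssocAlgebra.lift k x p =
    FreeNonUnitalNonAssocAlgebra.lift k x q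
  iseqv := ⟨fun _ _ => rfl, fun h x => (h x).symm, fun h h' x => (h x).trans (h' x)⟩
  mul' h h' x := by rw [map_mul, map_mul, h x, h' x]
  add' h h' x := by rw [map_add, map_add, h x, h' x]

/-- The identities of a variety hold in all its members, whatever their universe. -/
theorem Variety.IsIdentity.satisfies {V : Variety k} {p : FreeNonUnitalNonAssocAlgebra k ℕ}
    (hp : V.IsIdentity p) (hA : V.Mem A) : Satisfies A p := by
  let c := identityCon k A
  let m : FreeNonUnitalNonAssocAlgebra k ℕ →+ c.Quotient :=
    { toFun := fun q => (q : c.Quotient), map_zero' := rfl, map_add' := fun _ _ => rfl }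
  have hm : Function.Surjective m := Quotient.mk''_surjective
  let _ : SMul k c.Quotient := ⟨fun a => Quotient.map' (a • ·) fun q r (h : c q r) x => by
    rw [map_smul, map_smul, h x]⟩
  let _ : Module k c.Quotient := hm.module k m fun _ _ => rfl
  have _ : IsScalarTower k c.Quotient c.Quotient := ⟨fun a => by
    rintro ⟨y⟩ ⟨z⟩
    exact congrArg m (smul_mul_assoc a y z)⟩
  have _ : SMulCommClass k c.Quotient c.Quotient := ⟨fun a => by
    rintro ⟨y⟩ ⟨z⟩
    exact congrArg m (mul_smul_comm a y z).symm⟩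
  let M : FreeNonUnitalNonAssocAlgebra k ℕ →ₙₐ[k] c.Quotient :=
    { m with map_smul' := fun _ _ => rfl, map_mul' := fun _ _ => rfl }
  have hM : ∀ q, M q = 0 ↔ Satisfies A q := fun q => by
    refine (RingCon.eq c).trans (forall_congr' fun x => ?_)
    rw [map_zero]
  have hV : V.Mem c.Quotient := by
    intro q hq y
    choose z hz using fun n => hm (y n)
    have hy : y = M ∘ z := funext fun n => (hz n).symm
    rw [hy, ← map_lift, hM]
    intro x
    rw [map_lift]
    exact hA q hq _
  -- The quotient of the free algebra by the identities of `A` lives in the universe of `k`. At its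
  -- generic point, `p` vanishes exactly when it is an identity of `A`.
  have h := hp c.Quotient hV (M ∘ FreeNonUnitalNonAssocAlgebra.of k)
  rw [← map_lift, hM] at h
  have h1 : FreeNonUnitalNonAssocAlgebra.lift k (FreeNonUnitalNonAssocAlgebra.of k) p = p := by
    have : FreeNonUnitalNonAssocAlgebra.lift k (FreeNonUnitalNonAssocAlgebra.of k) =
        NonUnitalAlgHom.id k (FreeNonUnitalNonAssocAlgebra k ℕ) :=
      FreeNonUnitalNonAssocAlgebra.hom_ext k fun n => by simp
    rw [this]; rfl
  rwa [h1] at h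

/-- Homogeneity allows discarding from the separating combination every monomial whose letters
differ from those of `t`; the remaining ones have the length of `t`. -/
theorem Variety.IsIccSeparative.lift_mem_span {V : Variety k} {d : ℕ} (hV : V.IsIccSeparative d)
    (hA : V.Mem A) (x : ℕ → A) {t : FreeMagma ℕ} (ht : 1 < t.length) :
    FreeMagma.lift x t ∈ Submodule.span k
      (FreeMagma.lift x '' {s | IsIccSeparating 1 (1 + d) s ∧ s.length = t.length}) := by
  classical
  obtain ⟨q, hq, ⟨m, hm⟩, hid⟩ := hV t ht
  -- Evaluation at `x` of the component having the multidegree of `t`.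
  let E : FreeNonUnitalNonAssocAlgebra k ℕ →ₗ[k] A :=
    (Finsupp.linearCombination k fun s => if letters s = letters t then FreeMagma.lift x s else 0)
      ∘ₗ (MonoidAlgebra.coeffLinearEquiv k).toLinearMap
  have hE : ∀ s, E (mono k s) = if letters s = letters t then FreeMagma.lift x s else 0 := by
    intro s
    simp [E, mono]
  have h0 : E (mono k t - q) = 0 := by
    by_cases hmt : m = letters t
    · have : ∀ r ∈ Submodule.span k (mono k '' {s | letters s = m}),
          E r = FreeNonUnitalNonAssocAlgebra.lift k x r := by
        intro r hr
        induction hr using Submodule.span_induction with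
        | mem r hr =>
          obtain ⟨s, hs, rfl⟩ := hr
          rw [hE, lift_mono, if_pos (hs.trans hmt)]
        | zero => rw [map_zero, map_zero]
        | add a b _ _ ha hb => rw [map_add, map_add, ha, hb]
        | smul c a _ ha => rw [map_smul, map_smul, ha]
      rw [this _ hm]
      exact hid.satisfies hA x
    -- If the identity has another multidegree, `E` kills it term by term.
    · have : Submodule.span k (mono k '' {s | letters s = m}) ≤ LinearMap.ker E := by
        rw [Submodule.span_le]
        rintro _ ⟨s, hs, rfl⟩
        have hs' : letters s ≠ letters t := fun h => hmt (hs.symm.trans h)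
        simp [hE, hs']
      exact this hm
  rw [map_sub, hE, if_pos rfl, sub_eq_zero] at h0
  rw [h0]
  suffices h : Submodule.span k (mono k '' {s | IsIccSeparating 1 (1 + d) s}) ≤
      (Submodule.span k (FreeMagma.lift x ''
        {s | IsIccSeparating 1 (1 + d) s ∧ s.length = t.length})).comap E from h hq
  rw [Submodule.span_le]
  rintro _ ⟨s, hs, rfl⟩
  rw [SetLike.mem_coe]
  rw [Submodule.mem_comap, hE]
  split_ifs with h
  · refine Submodule.subset_span ⟨s, ⟨hs, ?_⟩, rfl⟩
    rw [length_eq_card_letters, h, length_eq_card_letters]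
  · exact zero_mem _

end Identities

/-! ### Multiplication operators and lower powers. -/

section Operators

variable {k : Type*} [Field k] {A : Type*} [NonUnitalNonAssocRing A] [Module k A]
  [IsScalarTower k A A] [SMulCommClass k A A]

theorem finite_image_length_le {x : ℕ → A} (hx : (Set.range x).Finite) (n : ℕ) :
    (FreeMagma.lift x '' {t | t.length ≤ n}).Finite := by
  induction n with
  | zero =>
    convert Set.finite_empty
    rw [Set.image_eq_empty, Set.eq_empty_iff_forall_notMem]
    intro t ht
    exact absurd t.length_pos (by simpa using ht)
  | succ n ih =>
    refine (hx.union (ih.image2 (· * ·) ih)).subset ?_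
    rintro _ ⟨t, ht, rfl⟩
    cases t with
    | of i => exact Or.inl ⟨i, by simp⟩
    | mul a b =>
      have ht' : a.length + b.length ≤ n + 1 := ht
      have := a.length_pos
      have := b.length_pos
      exact Or.inr ⟨_, ⟨a, show a.length ≤ n by omega, rfl⟩, _,
        ⟨b, show b.length ≤ n by omega, rfl⟩, (map_mul (FreeMagma.lift x) a b).symm⟩

variable (k) in
/-- The left and right multiplications by the values at `x` of the monomials of length
at most `n`. -/
def mulOps (x : ℕ → A) (n : ℕ) : Set (Module.End k A) :=
  LinearMap.mulLeft k '' (FreeMagma.lift x '' {t | t.length ≤ n}) ∪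
    LinearMap.mulRight k '' (FreeMagma.lift x '' {t | t.length ≤ n})

open scoped Pointwise

variable (k) in
/-- The products of at least one and at most `n + 1` elements of `mulOps k x n`. -/
def prodOps (x : ℕ → A) (n : ℕ) : Set (Module.End k A) :=
  mulOps k x n * insert 1 (mulOps k x n) ^ n

theorem finite_pow {M : Type*} [Monoid M] {S : Set M} (hS : S.Finite) (n : ℕ) :
    (S ^ n).Finite := by
  induction n with
  | zero => rw [pow_zero]; exact Set.finite_one
  | succ n ih => rw [pow_succ]; exact ih.mul hS

theorem finite_prodOps {x : ℕ → A} (hx : (Set.range x).Finite) (n : ℕ) :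
    (prodOps k x n).Finite := by
  have h : (mulOps k x n).Finite :=
    ((finite_image_length_le hx n).image _).union ((finite_image_length_le hx n).image _)
  exact h.mul (finite_pow (h.insert 1) n)

theorem IsSubmonomial.length_le {u t : FreeMagma ℕ} (h : IsSubmonomial u t) :
    u.length ≤ t.length := by
  induction h with
  | refl => exact le_rfl
  | left b _ ih => exact ih.trans (Nat.le_add_right _ _)
  | right a _ ih => exact ih.trans (Nat.le_add_left _ _)

/-- Climbing from `u` to `t` multiplies at each stage by a monomial of length at least one. A length
deficit of at most `m` thus bounds both the number of stages and the lengths of the multipliers by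
`m`. -/
theorem IsSubmonomial.lift_eq {u t : FreeMagma ℕ} (h : IsSubmonomial u t) (x : ℕ → A) {n : ℕ} :
    ∀ {m : ℕ}, m ≤ n → t.length ≤ u.length + m → t = u ∨
      ∃ T ∈ mulOps k x n * insert 1 (mulOps k x n) ^ m,
        FreeMagma.lift x t = T (FreeMagma.lift x u) := by
  have step : ∀ {a : FreeMagma ℕ} {m : ℕ} {g : Module.End k A}, g ∈ mulOps k x n →
      (a = u ∨ ∃ T ∈ mulOps k x n * insert 1 (mulOps k x n) ^ m,
        FreeMagma.lift x a = T (FreeMagma.lift x u)) →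
      ∃ T ∈ mulOps k x n * insert 1 (mulOps k x n) ^ (m + 1),
        g (FreeMagma.lift x a) = T (FreeMagma.lift x u) := by
    rintro a m g hg (rfl | ⟨T, hT, h⟩)
    · exact ⟨g * 1, Set.mul_mem_mul hg (Set.one_mem_pow (Set.mem_insert _ _)), by simp⟩
    · refine ⟨g * T, Set.mul_mem_mul hg ?_, by rw [h]; rfl⟩
      rw [pow_succ']
      exact Set.mul_subset_mul_right (Set.subset_insert _ _) hT
  induction h with
  | refl => exact fun _ _ => Or.inl rfl
  | @left a b hab ih =>
    intro m hm hl
    have hl' : a.length + b.length ≤ u.length + m := hl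
    have := hab.length_le
    have := b.length_pos
    obtain ⟨m, rfl⟩ : ∃ m', m = m' + 1 := ⟨m - 1, by omega⟩
    obtain ⟨T, hT, h⟩ := step (g := LinearMap.mulRight k (FreeMagma.lift x b))
      (Or.inr ⟨_, ⟨b, show b.length ≤ n by omega, rfl⟩, rfl⟩)
      (ih (show m ≤ n by omega) (by omega))
    exact Or.inr ⟨T, hT, by rw [← h, map_mul]; rfl⟩
  | @right b a hab ih =>
    intro m hm hl
    have hl' : a.length + b.length ≤ u.length + m := hl
    have := hab.length_le
    have := a.length_pos
    obtain ⟨m, rfl⟩ : ∃ m', m = m' + 1 := ⟨m - 1, by omega⟩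
    obtain ⟨T, hT, h⟩ := step (g := LinearMap.mulLeft k (FreeMagma.lift x a))
      (Or.inl ⟨_, ⟨a, show a.length ≤ n by omega, rfl⟩, rfl⟩)
      (ih (show m ≤ n by omega) (by omega))
    exact Or.inr ⟨T, hT, by rw [← h, map_mul]; rfl⟩

/-- A separating monomial has its value in the range of a product operator. -/
theorem IsIccSeparating.exists_lift_eq {n : ℕ} {s : FreeMagma ℕ} (h : IsIccSeparating 1 n s)
    (x : ℕ → A) : ∃ u : FreeMagma ℕ, s.length ≤ u.length + n ∧
      ∃ T ∈ prodOps k x n, FreeMagma.lift x s = T (FreeMagma.lift x u) := by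
  obtain ⟨m, h1, hn, u, hu, hl⟩ := h
  refine ⟨u, by omega, ?_⟩
  rcases hu.lift_eq (k := k) x le_rfl (show s.length ≤ u.length + n by omega) with rfl | h
  -- A separating submonomial is proper, since the length deficit is at least 1.
  · omega
  · exact h

/-- Each use of separativity extracts one operator and costs at most `1 + d` letters, so more than
`N * (1 + d)` letters suffice for `N` uses. -/
theorem lift_mem_iSup_range {k : Type u} [Field k] [Module k A]
    [IsScalarTower k A A] [SMulCommClass k A A] {V : Variety k} {d : ℕ} (hV : V.IsIccSeparative d)
    (hA : V.Mem A) (x : ℕ → A) (N : ℕ) {t : FreeMagma ℕ} (ht : N * (1 + d) < t.length) :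
    FreeMagma.lift x t ∈ ⨆ T ∈ prodOps k x (1 + d) ^ N, LinearMap.range T := by
  induction N generalizing t with
  | zero =>
    rw [pow_zero]
    refine Submodule.mem_iSup_of_mem 1 (Submodule.mem_iSup_of_mem (Set.mem_one.2 rfl) ?_)
    exact ⟨_, rfl⟩
  | succ N ih =>
    rw [add_mul, one_mul] at ht
    refine Submodule.span_le.2 ?_ (hV.lift_mem_span hA x (show 1 < t.length by omega))
    rintro _ ⟨s, ⟨hs, hst⟩, rfl⟩
    obtain ⟨u, hu, T, hT, h⟩ := hs.exists_lift_eq (k := k) x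
    rw [SetLike.mem_coe, h]
    have hle : (⨆ S ∈ prodOps k x (1 + d) ^ N, LinearMap.range S) ≤
        (⨆ S ∈ prodOps k x (1 + d) ^ (N + 1), LinearMap.range S).comap T := by
      refine iSup₂_le fun S hS => ?_
      rintro _ ⟨y, rfl⟩
      refine Submodule.mem_iSup_of_mem (T * S) (Submodule.mem_iSup_of_mem ?_ ⟨y, rfl⟩)
      rw [pow_succ']
      exact Set.mul_mem_mul hT hS
    exact hle (ih (by omega))

variable (k) in
theorem mul_mem_lowerPower_succ_left (a : A) {n : ℕ} {b : A} (hb : b ∈ lowerPower k A n) :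
    a * b ∈ lowerPower k A (n + 1) := by
  cases n with
  | zero => rw [lowerPower]; trivial
  | succ n =>
    rw [lowerPower]
    refine Submodule.mem_iSup_of_mem (0 : Fin (n + 1)) (Submodule.apply_mem_map₂ _ ?_ hb)
    change a ∈ lowerPower k A 1
    rw [lowerPower]; trivial

variable (k) in
theorem mul_mem_lowerPower_succ_right (a : A) {n : ℕ} {b : A} (hb : b ∈ lowerPower k A n) :
    b * a ∈ lowerPower k A (n + 1) := by
  cases n with
  | zero => rw [lowerPower]; trivial
  | succ n =>
    rw [lowerPower]
    refine Submodule.mem_iSup_of_mem (Fin.last n) (Submodule.apply_mem_map₂ _ hb ?_)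
    have : n + 1 - (Fin.last n : ℕ) = 1 := by simp
    rw [this, lowerPower]; trivial

variable (k A) in
theorem lowerPower_succ_le (n : ℕ) : lowerPower k A (n + 1) ≤ lowerPower k A n := by
  induction n using Nat.strong_induction_on with
  | _ n ih =>
    match n with
    | 0 => rw [lowerPower, lowerPower]
    | 1 => rw [lowerPower.eq_2]; exact le_top
    | n + 2 =>
      rw [lowerPower]
      refine iSup_le fun m => Submodule.map₂_le.2 fun a ha b hb => ?_
      obtain ⟨m, hm⟩ := m
      rcases Nat.lt_or_ge m (n + 1) with h | h
      · rw [lowerPower]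
        refine Submodule.mem_iSup_of_mem (⟨m, h⟩ : Fin (n + 1)) (Submodule.apply_mem_map₂ _ ha ?_)
        have e : n + 1 + 1 - m = n + 1 - m + 1 := by omega
        rw [e] at hb
        exact ih _ (by omega) hb
      -- Here the right factor is only known to lie in A₍₁₎, so the index of the left factor is
      -- lowered instead.
      · obtain rfl : m = n + 1 := by omega
        exact mul_mem_lowerPower_succ_right k b (ih (n + 1) (by omega) ha)

variable (k A) in
theorem antitone_lowerPower : Antitone (lowerPower k A) :=
  antitone_nat_of_succ_le (lowerPower_succ_le k A)

theorem map_mem_lowerPower {B : Type*} [NonUnitalNonAssocRing B] [Module k B]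
    [IsScalarTower k B B] [SMulCommClass k B B] (φ : A →ₙₐ[k] B) (n : ℕ) {a : A}
    (ha : a ∈ lowerPower k A n) : φ a ∈ lowerPower k B n := by
  induction n using Nat.strong_induction_on generalizing a with
  | _ n ih =>
    match n with
    | 0 => rw [lowerPower]; trivial
    | 1 => rw [lowerPower]; trivial
    | n + 2 =>
      suffices h : lowerPower k A (n + 2) ≤ (lowerPower k B (n + 2)).comap (φ : A →ₗ[k] B) from
        h ha
      rw [lowerPower, lowerPower]
      refine iSup_le fun m => Submodule.map₂_le.2 fun a ha b hb => ?_
      refine Submodule.mem_iSup_of_mem m ?_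
      change φ (a * b) ∈ _
      rw [map_mul]
      exact Submodule.apply_mem_map₂ _ (ih _ (by omega) ha) (ih _ (by omega) hb)

theorem lift_mem_lowerPower (x : ℕ → A) (t : FreeMagma ℕ) :
    FreeMagma.lift x t ∈ lowerPower k A t.length := by
  induction t with
  | ih1 i =>
    change _ ∈ lowerPower k A 1
    rw [lowerPower]; trivial
  | ih2 a b ha hb =>
    have e : (a * b).length = a.length + b.length := rfl
    have := a.length_pos
    have := b.length_pos
    obtain ⟨p, hp⟩ : ∃ p, a.length = p + 1 := ⟨a.length - 1, by omega⟩
    obtain ⟨q, hq⟩ : ∃ q, b.length = q + 1 := ⟨b.length - 1, by omega⟩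
    rw [hp] at ha
    rw [hq] at hb
    rw [e, hp, hq, show p + 1 + (q + 1) = p + q + 2 by ring, lowerPower]
    refine Submodule.mem_iSup_of_mem (⟨p, by omega⟩ : Fin (p + q + 1)) ?_
    refine Submodule.apply_mem_map₂ _ ha ?_
    rwa [show p + q + 1 - p = q + 1 by omega]

variable (k A) in
/-- The operators that map each `A₍ₙ₎` into `A₍ₙ₊₁₎`. -/
def raisingOps : NonUnitalSubalgebra k (Module.End k A) where
  carrier := {T | ∀ n, ∀ a ∈ lowerPower k A n, T a ∈ lowerPower k A (n + 1)}
  add_mem' hS hT n a ha := add_mem (hS n a ha) (hT n a ha)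
  zero_mem' _ _ _ := zero_mem _
  mul_mem' hS hT n a ha := lowerPower_succ_le k A _ (hS _ _ (hT n a ha))
  smul_mem' c _ hT n a ha := Submodule.smul_mem _ c (hT n a ha)

theorem pow_apply_mem_lowerPower {T : Module.End k A} (hT : T ∈ raisingOps k A) (n : ℕ) (a : A) :
    (T ^ n) a ∈ lowerPower k A (n + 1) := by
  induction n with
  | zero => rw [lowerPower]; trivial
  | succ n ih => rw [pow_succ']; exact hT _ _ ih

theorem mulOps_subset_raisingOps (x : ℕ → A) (n : ℕ) :
    mulOps k x n ⊆ raisingOps k A := by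
  rintro _ (⟨a, -, rfl⟩ | ⟨a, -, rfl⟩)
  · exact fun n b hb => mul_mem_lowerPower_succ_left k a hb
  · exact fun n b hb => mul_mem_lowerPower_succ_right k a hb

theorem prodOps_subset_raisingOps (x : ℕ → A) (n : ℕ) :
    prodOps k x n ⊆ raisingOps k A := by
  have h : ∀ m, ∀ T ∈ insert 1 (mulOps k x n) ^ m, ∀ S ∈ raisingOps k A,
      S * T ∈ raisingOps k A := by
    intro m
    induction m with
    | zero => 
      intro T hT S hS
      rw [pow_zero, Set.mem_one] at hT
      rwa [hT, mul_one]
    | succ m ih =>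
      intro T hT S hS
      rw [pow_succ'] at hT
      obtain ⟨T₁, hT₁, T₂, hT₂, rfl⟩ := hT
      change S * (T₁ * T₂) ∈ _
      rw [← mul_assoc]
      refine ih T₂ hT₂ _ ?_
      rcases hT₁ with rfl | hT₁
      · rwa [mul_one]
      · exact mul_mem hS (mulOps_subset_raisingOps x n hT₁)
  rintro _ ⟨S, hS, T, hT, rfl⟩
  exact h n T hT S (mulOps_subset_raisingOps x n hS)

theorem iSup_range_le_lowerPower (x : ℕ → A) (n N : ℕ) :
    ⨆ T ∈ prodOps k x n ^ N, LinearMap.range T ≤ lowerPower k A (N + 1) := by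
  refine iSup₂_le fun T hT => ?_
  induction N generalizing T with
  | zero => rw [lowerPower]; exact le_top
  | succ N ih =>
    rw [pow_succ'] at hT
    obtain ⟨T₁, hT₁, T₂, hT₂, rfl⟩ := hT
    rintro _ ⟨a, rfl⟩
    exact prodOps_subset_raisingOps x n hT₁ _ _ (ih T₂ hT₂ ⟨a, rfl⟩)

end Operators

end NAAlg

namespace NAAlg

/-! ### Linear compactness: a space as the dual of a space of functionals. -/

section Duality

variable {k : Type*} [Field k] {A : Type*} [AddCommGroup A] [Module k A]

theorem exists_dual_comp_eq {W : Type*} [AddCommGroup W] [Module k W] (Φ : A →ₗ[k] W)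
    (e : Module.Dual k A) (h : ∀ a, Φ a = 0 → e a = 0) : ∃ ξ : Module.Dual k W, ξ ∘ₗ Φ = e := by
  have he : e ∈ LinearMap.range Φ.dualMap := by
    rw [LinearMap.range_dualMap_eq_dualAnnihilator_ker, Submodule.mem_dualAnnihilator]
    exact h
  exact he

/-- A closed range theorem. Evaluation at `a` kills the kernel of the joint transpose `Φ`, so it
factors through `Φ`. The factor `ξ` splits into finitely many functionals on `D`, each evaluation at
some `b T`, and separation gives `a = ∑ T (b T)`. -/
theorem mem_iSup_range_of_forall_dual (D : Submodule k (Module.Dual k A))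
    (hrefl : ∀ ξ : Module.Dual k D, ∃ a : A, ∀ l : D, ξ l = l.1 a)
    (hsep : ∀ a : A, (∀ l ∈ D, l a = 0) → a = 0) {P : Set (Module.End k A)} (hP : P.Finite)
    (hPD : ∀ T ∈ P, ∀ l ∈ D, l ∘ₗ T ∈ D) {a : A}
    (ha : ∀ l ∈ D, (∀ T ∈ P, l ∘ₗ T = 0) → l a = 0) :
    a ∈ ⨆ T ∈ P, LinearMap.range T := by
  classical
  have _ := hP.fintype
  let Φ : D →ₗ[k] P → D := LinearMap.pi fun T =>
    ((LinearMap.lcomp k k T.1).comp D.subtype).codRestrict D fun l => hPD T.1 T.2 l.1 l.2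
  have hΦ : ∀ l T, (Φ l T).1 = l.1 ∘ₗ T.1 := fun _ _ => rfl
  let e : Module.Dual k D := (Module.Dual.eval k A a).comp D.subtype
  obtain ⟨ξ, hξ⟩ := exists_dual_comp_eq (A := D) (W := P → D) Φ e fun l hl => by
    refine ha l.1 l.2 fun T hT => ?_
    rw [← hΦ l ⟨T, hT⟩, hl]
    rfl
  choose b hb using fun T : P => hrefl (ξ ∘ₗ LinearMap.single k (fun _ : P => D) T)
  have hab : a = ∑ T : P, T.1 (b T) := by
    rw [← sub_eq_zero]
    refine hsep _ fun l hl => ?_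
    rw [map_sub, sub_eq_zero, map_sum]
    have h1 : l a = ξ (Φ ⟨l, hl⟩) := (LinearMap.congr_fun hξ ⟨l, hl⟩).symm
    rw [h1, ← Finset.univ_sum_single (Φ ⟨l, hl⟩), map_sum]
    refine Finset.sum_congr rfl fun T _ => ?_
    exact hb T (Φ ⟨l, hl⟩ T)
  rw [hab]
  exact sum_mem fun T _ => Submodule.mem_iSup_of_mem T.1 (Submodule.mem_iSup_of_mem T.2 ⟨_, rfl⟩)

/-- The functionals in `D` annihilating all the ranges embed by restriction into the dual of `F`.
They form a finite-dimensional space, and a finite spanning set of it cuts out the sum of ranges. -/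
theorem exists_finset_dual_forall_mem_iSup_range (D : Submodule k (Module.Dual k A))
    (hrefl : ∀ ξ : Module.Dual k D, ∃ a : A, ∀ l : D, ξ l = l.1 a)
    (hsep : ∀ a : A, (∀ l ∈ D, l a = 0) → a = 0) {P : Set (Module.End k A)} (hP : P.Finite)
    (hPD : ∀ T ∈ P, ∀ l ∈ D, l ∘ₗ T ∈ D) (F : Submodule k A) [FiniteDimensional k F]
    (hF : ∀ l ∈ D, (∀ a ∈ F, l a = 0) → (∀ T ∈ P, l ∘ₗ T = 0) → l = 0) :
    ∃ s : Finset (Module.Dual k A), (s : Set (Module.Dual k A)) ⊆ D ∧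
      ∀ a : A, (∀ l ∈ s, l a = 0) → a ∈ ⨆ T ∈ P, LinearMap.range T := by
  let M : Submodule k (Module.Dual k A) :=
    D ⊓ ⨅ T ∈ P, LinearMap.ker (LinearMap.lcomp k k T)
  have hM : ∀ l, l ∈ M ↔ l ∈ D ∧ ∀ T ∈ P, l ∘ₗ T = 0 := by
    intro l
    simp only [M, Submodule.mem_inf, Submodule.mem_iInf, LinearMap.mem_ker]
    rfl
  let ρ : M →ₗ[k] Module.Dual k F := (LinearMap.lcomp k k F.subtype).comp M.subtype
  have hρ : Function.Injective ρ := by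
    rw [injective_iff_map_eq_zero]
    intro l hl
    refine Subtype.ext (hF l.1 ((hM _).1 l.2).1 (fun a ha => ?_) ((hM _).1 l.2).2)
    exact LinearMap.congr_fun hl ⟨a, ha⟩
  have _ : FiniteDimensional k M := FiniteDimensional.of_injective ρ hρ
  obtain ⟨s, hs⟩ := (Module.Finite.iff_fg.1 ‹FiniteDimensional k M› : M.FG)
  refine ⟨s, fun l hl => ((hM l).1 (hs ▸ Submodule.subset_span hl)).1, fun a ha => ?_⟩
  refine mem_iSup_range_of_forall_dual D hrefl hsep hP hPD fun l hl hlP => ?_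
  have hl' : l ∈ Submodule.span k (s : Set (Module.Dual k A)) := hs ▸ (hM l).2 ⟨hl, hlP⟩
  have hle : Submodule.span k (s : Set (Module.Dual k A)) ≤
      LinearMap.ker (Module.Dual.eval k A a) := Submodule.span_le.2 fun l hl => ha l hl
  exact hle hl'

end Duality

/-! ### Finitely generated subalgebras as spans of monomials. -/

section Generation

variable {k : Type*} [Field k] {A : Type*} [NonUnitalNonAssocRing A] [Module k A]
  [IsScalarTower k A A] [SMulCommClass k A A]

theorem exists_seq_finite_range_of_finset (s : Finset A) :
    ∃ x : ℕ → A, (Set.range x).Finite ∧ (s : Set A) ⊆ Set.range x := by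
  refine ⟨fun n => s.toList.getD n 0, (s.finite_toSet.insert 0).subset ?_, fun a ha => ?_⟩
  · rintro _ ⟨n, rfl⟩
    by_cases h : n < s.toList.length
    · right
      simp only [List.getD_eq_getElem _ _ h]
      exact Finset.mem_toList.1 (List.getElem_mem h)
    · left
      exact List.getD_eq_default _ _ (not_lt.1 h)
  · obtain ⟨n, hn, h⟩ := List.getElem_of_mem (Finset.mem_toList.2 ha)
    exact ⟨n, by simp only [List.getD_eq_getElem _ _ hn, h]⟩

theorem mem_span_range_lift_of_mem_adjoin {x : ℕ → A} {s : Set A} (hs : s ⊆ Set.range x) {a : A}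
    (ha : a ∈ NonUnitalAlgebra.adjoin k s) :
    a ∈ Submodule.span k (Set.range (FreeMagma.lift x)) := by
  induction ha using NonUnitalAlgebra.adjoin_induction with
  | mem a ha =>
    obtain ⟨n, rfl⟩ := hs ha
    exact Submodule.subset_span ⟨FreeMagma.of n, by simp⟩
  | add a b _ _ ha hb => exact add_mem ha hb
  | zero => exact zero_mem _
  | smul c a _ ha => exact Submodule.smul_mem _ c ha
  | mul a b _ _ ha hb =>
    have h := Submodule.apply_mem_map₂ (LinearMap.mul k A) ha hb
    rw [Submodule.map₂_span_span] at h
    refine Submodule.span_mono ?_ h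
    rintro _ ⟨_, ⟨t, rfl⟩, _, ⟨u, rfl⟩, rfl⟩
    exact ⟨t * u, map_mul _ _ _⟩

end Generation

/-! ### A Nakayama argument and homomorphisms to finite-dimensional algebras. -/

section Nakayama

variable {k : Type*} [Field k] {A : Type*} [NonUnitalNonAssocRing A] [Module k A]
  [IsScalarTower k A A] [SMulCommClass k A A]

variable (k) in
/-- The operators that preserve a given subspace. -/
def preservingOps {A : Type*} [AddCommGroup A] [Module k A] (K : Submodule k A) :
    NonUnitalSubalgebra k (Module.End k A) where
  carrier := {T | ∀ a ∈ K, T a ∈ K}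
  add_mem' hS hT a ha := add_mem (hS a ha) (hT a ha)
  zero_mem' _ _ := zero_mem _
  mul_mem' hS hT a ha := hS _ (hT a ha)
  smul_mem' c _ hT a ha := Submodule.smul_mem _ c (hT a ha)

/-- A form of Nakayama's lemma for an algebra `R` of operators on a vector space, relative to
a subspace of finite codimension. -/
theorem le_of_le_sup_span_of_surjective_sub {A : Type*} [AddCommGroup A] [Module k A]
    (R : NonUnitalSubalgebra k (Module.End k A))
    (hR : ∀ T ∈ R, ∀ b, ∃ a, a - T a = b) {K X : Submodule k A} [FiniteDimensional k (A ⧸ K)]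
    (hK : ∀ T ∈ R, ∀ a ∈ K, T a ∈ K) (hKX : K ≤ X) (hX : ∀ T ∈ R, ∀ a ∈ X, T a ∈ X)
    (h : X ≤ K ⊔ Submodule.span k {b | ∃ T ∈ R, ∃ a ∈ X, T a = b}) : X ≤ K := by
  by_contra hXK
  have hKX' : K < X := lt_of_le_not_ge hKX hXK
  -- `Y`, the preimage of `Z`, is a maximal `R`-stable subspace with `K ≤ Y < X`; it exists because
  -- `K` has finite codimension.
  obtain ⟨Z, ⟨hZX, hZR⟩, hmax⟩ := (wellFounded_gt (α := Submodule k (A ⧸ K))).has_min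
    {Z | Z.comap K.mkQ < X ∧ ∀ T ∈ R, ∀ a ∈ Z.comap K.mkQ, T a ∈ Z.comap K.mkQ}
    ⟨⊥, by rwa [Submodule.comap_bot, Submodule.ker_mkQ],
      by rwa [Submodule.comap_bot, Submodule.ker_mkQ]⟩
  set Y := Z.comap K.mkQ with hY
  have hKY : K ≤ Y := fun a ha => by
    rw [hY, Submodule.mem_comap, Submodule.mkQ_apply, (Submodule.Quotient.mk_eq_zero K).2 ha]
    exact zero_mem _
  obtain ⟨x, hxX, hxY⟩ := SetLike.exists_of_lt hZX
  let Rx : Submodule k A := R.toSubmodule.map (LinearMap.applyₗ x)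
  have hRx : ∀ b, b ∈ Rx ↔ ∃ T ∈ R, T x = b := fun b => Iff.rfl
  let Y' : Submodule k A := Y ⊔ (k ∙ x) ⊔ Rx
  have hY'R : ∀ T ∈ R, ∀ a ∈ Y', T a ∈ Y ⊔ Rx := by
    intro T hT
    suffices h : Y' ≤ (Y ⊔ Rx).comap T from h
    refine sup_le (sup_le (fun a ha => ?_) ?_) ?_
    · exact Submodule.mem_sup_left (hZR T hT a ha)
    · rw [Submodule.span_singleton_le_iff_mem]
      exact Submodule.mem_sup_right ((hRx _).2 ⟨T, hT, rfl⟩)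
    · intro b hb
      obtain ⟨S, hS, rfl⟩ := (hRx b).1 hb
      exact Submodule.mem_sup_right ((hRx _).2 ⟨T * S, mul_mem hT hS, rfl⟩)
  have hYY' : Y ⊔ Rx ≤ Y' := sup_le (le_sup_left.trans le_sup_left) le_sup_right
  have hY'X : Y' ≤ X := by
    refine sup_le (sup_le hZX.le ((Submodule.span_singleton_le_iff_mem _ _).2 hxX)) fun b hb => ?_
    obtain ⟨S, hS, rfl⟩ := (hRx b).1 hb
    exact hX S hS x hxX
  have hxY' : x ∈ Y' :=
    Submodule.mem_sup_left (Submodule.mem_sup_right (Submodule.mem_span_singleton_self x))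
  have hc : (Y'.map K.mkQ).comap K.mkQ = Y' := by
    rw [Submodule.comap_map_eq, Submodule.ker_mkQ, sup_eq_left]
    exact hKY.trans (le_sup_left.trans le_sup_left)
  -- `Y'` is `R`-stable and strictly larger than `Y`, so maximality forces it to be all of `X`.
  have hXY' : X ≤ Y' := by
    by_contra hne
    refine hmax (Y'.map K.mkQ) ⟨?_, ?_⟩ ?_
    · rw [hc]; exact lt_of_le_not_ge hY'X hne
    · rw [hc]; exact fun T hT a ha => hYY' (hY'R T hT a ha)
    · refine lt_of_le_not_ge ?_ fun hle => hxY ?_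
      · intro z hz
        obtain ⟨a, rfl⟩ := K.mkQ_surjective z
        exact ⟨a, Submodule.mem_sup_left (Submodule.mem_sup_left hz), rfl⟩
      · exact hle ⟨x, hxY', rfl⟩
  have hx : x ∈ Y ⊔ Rx := by
    refine (h.trans (sup_le (hKY.trans le_sup_left) (Submodule.span_le.2 ?_))) hxX
    rintro _ ⟨T, hT, a, ha, rfl⟩
    exact hY'R T hT a (hXY' ha)
  -- Now `x = y + T x`, so `1 - T` kills the nonzero class of `x` modulo `Y`. But `1 - T` is
  -- surjective, hence injective, on the finite-dimensional quotient by `Y`.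
  obtain ⟨y, hy, b, hb, hyb⟩ := Submodule.mem_sup.1 hx
  obtain ⟨T, hT, rfl⟩ := (hRx b).1 hb
  have _ : FiniteDimensional k (A ⧸ Y) :=
    Module.Finite.of_surjective (Submodule.factor hKY) (Submodule.factor_surjective hKY)
  let U : Module.End k (A ⧸ Y) := Y.mapQ Y (LinearMap.id - T) fun a ha =>
    sub_mem ha (hZR T hT a ha)
  have hU : Function.Surjective U := by
    intro z
    obtain ⟨b, rfl⟩ := Y.mkQ_surjective z
    obtain ⟨a, rfl⟩ := hR T hT b
    exact ⟨Y.mkQ a, rfl⟩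
  have hU0 : U (Y.mkQ x) = 0 := by
    change Y.mkQ (x - T x) = 0
    rw [Submodule.mkQ_apply, Submodule.Quotient.mk_eq_zero]
    have : x - T x = y := sub_eq_iff_eq_add.2 hyb.symm
    rwa [this]
  have := (injective_iff_map_eq_zero U).1 (LinearMap.injective_iff_surjective.2 hU) _ hU0
  rw [Submodule.mkQ_apply, Submodule.Quotient.mk_eq_zero] at this
  exact hxY this

/-- Modulo the kernel the lower powers stabilize. A product in a sufficiently deep lower power has a
factor in the stable one, so the stable image is reproduced by multiplication operators and Nakayama
makes it vanish. -/
theorem exists_lowerPower_le_ker {B : Type*} [NonUnitalNonAssocRing B] [Module k B]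
    [FiniteDimensional k B] (φ : A →ₙₐ[k] B)
    {R₀ : NonUnitalSubalgebra k (Module.End k A)} (hR₀ : R₀ ≤ raisingOps k A)
    (hleft : ∀ a, LinearMap.mulLeft k a ∈ R₀) (hright : ∀ a, LinearMap.mulRight k a ∈ R₀)
    (hA : ∀ T ∈ R₀, ∀ b, ∃ a, a - T a = b) :
    ∃ n, ∀ a ∈ lowerPower k A n, φ a = 0 := by
  let K : Submodule k A := LinearMap.ker (φ : A →ₗ[k] B)
  have hK : ∀ a, a ∈ K ↔ φ a = 0 := fun _ => Iff.rfl
  have _ : FiniteDimensional k (A ⧸ K) :=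
    FiniteDimensional.of_injective ((φ : A →ₗ[k] B).quotKerEquivRange.toLinearMap)
      (LinearEquiv.injective _)
  obtain ⟨n₀, hn₀⟩ := WellFoundedGT.monotone_chain_condition (α := (Submodule k (A ⧸ K))ᵒᵈ)
    ⟨fun n => OrderDual.toDual ((lowerPower k A (n + 1)).map K.mkQ), fun m n h =>
      Submodule.map_mono (antitone_lowerPower k A (Nat.succ_le_succ h))⟩
  -- The index `2 * n₀ + 2` ensures that in every product of complementary lower powers at least one
  -- factor lies in A₍n₀+1₎.
  have hstab : (lowerPower k A (n₀ + 1)).map K.mkQ =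
      (lowerPower k A (n₀ + n₀ + 2)).map K.mkQ :=
    congrArg OrderDual.ofDual (hn₀ (n₀ + n₀ + 1) (by omega))
  let X := K ⊔ lowerPower k A (n₀ + 1)
  let R := R₀ ⊓ preservingOps k K
  have hX : X ≤ K ⊔ lowerPower k A (n₀ + n₀ + 2) := by
    refine sup_le le_sup_left ?_
    rw [← Submodule.ker_mkQ K, sup_comm, ← Submodule.comap_map_eq, ← hstab]
    exact Submodule.le_comap_map _ _
  have hL : ∀ a, LinearMap.mulLeft k a ∈ R := fun a =>
    ⟨hleft a, fun b hb => by
      rw [hK] at hb ⊢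
      rw [LinearMap.mulLeft_apply, map_mul, hb, mul_zero]⟩
  have hR : ∀ a, LinearMap.mulRight k a ∈ R := fun a =>
    ⟨hright a, fun b hb => by
      rw [hK] at hb ⊢
      rw [LinearMap.mulRight_apply, map_mul, hb, zero_mul]⟩
  have hXK : X ≤ K := by
    refine le_of_le_sup_span_of_surjective_sub R (fun T hT => hA T hT.1) (fun T hT => hT.2)
      le_sup_left (fun T hT => ?_) (hX.trans (sup_le_sup_left ?_ K))
    · suffices h : X ≤ X.comap T from h
      exact sup_le (fun a ha => Submodule.mem_sup_left (hT.2 a ha))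
        fun a ha => Submodule.mem_sup_right (lowerPower_succ_le k A _ (hR₀ hT.1 _ a ha))
    · rw [lowerPower]
      refine iSup_le fun m => Submodule.map₂_le.2 fun a ha b hb => Submodule.subset_span ?_
      rcases Nat.lt_or_ge m n₀ with h | h
      · exact ⟨_, hL a, b, Submodule.mem_sup_right (antitone_lowerPower k A (by omega) hb), rfl⟩
      · exact ⟨_, hR b, a, Submodule.mem_sup_right (antitone_lowerPower k A (by omega) ha), rfl⟩
  exact ⟨n₀ + 1, fun a ha => hXK (Submodule.mem_sup_right ha)⟩

end Nakayama

end NAAlg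

namespace NAAlg

/-! ### Inverse limits, their continuous functionals and their topology. -/

section Limit

variable {k : Type u} [Field k] {I : Type w} [Preorder I] {A : I → Type v}
  [∀ i, NonUnitalNonAssocRing (A i)] [∀ i, Module k (A i)]
  (f : ∀ ⦃i j : I⦄, i ≤ j → A j →ₙₐ[k] A i)

/-- The projections of an inverse limit. -/
def invLimitProj (i : I) : invLimit f →ₙₐ[k] A i where
  toFun a := a.1 i
  map_smul' _ _ := rfl
  map_zero' := rfl
  map_add' _ _ := rfl
  map_mul' _ _ := rfl

/-- The linear functionals on an inverse limit that factor through finitely many of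
the projections. -/
def coordDual : Submodule k (Module.Dual k (invLimit f)) :=
  ⨆ i, LinearMap.range (invLimitProj f i : invLimit f →ₗ[k] A i).dualMap

variable {f}

theorem comp_invLimitProj_mem_coordDual (i : I) (m : Module.Dual k (A i)) :
    m ∘ₗ (invLimitProj f i : invLimit f →ₗ[k] A i) ∈ coordDual f :=
  Submodule.mem_iSup_of_mem i ⟨m, rfl⟩

theorem coordDual_le {S : Submodule k (Module.Dual k (invLimit f))}
    (h : ∀ i (m : Module.Dual k (A i)), m ∘ₗ (invLimitProj f i : invLimit f →ₗ[k] A i) ∈ S) :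
    coordDual f ≤ S := by
  refine iSup_le fun i => ?_
  rintro _ ⟨m, rfl⟩
  exact h i m

theorem eq_zero_of_forall_coordDual {a : invLimit f} (h : ∀ l ∈ coordDual f, l a = 0) :
    a = 0 := by
  refine Subtype.ext (funext fun i => ?_)
  refine (Module.forall_dual_apply_eq_zero_iff k _).1 fun m => ?_
  exact h _ (comp_invLimitProj_mem_coordDual i m)

/-- On functionals through one projection, `ξ` is an element of the bidual of a finite-dimensional
image, hence evaluation at a point of it. These points are compatible because functionals separate
points of `A i`. -/
theorem exists_eq_apply_of_dual_coordDual
    (hfd : ∀ i, FiniteDimensional k (LinearMap.range (invLimitProj f i : invLimit f →ₗ[k] A i)))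
    (ξ : Module.Dual k (coordDual f)) : ∃ a : invLimit f, ∀ l : coordDual f, ξ l = l.1 a := by
  have key : ∀ i, ∃ b : A i, ∀ m : Module.Dual k (A i),
      m b = ξ ⟨_, comp_invLimitProj_mem_coordDual i m⟩ := by
    intro i
    let p : invLimit f →ₗ[k] A i := invLimitProj f i
    have hp : ∀ m : Module.Dual k (LinearMap.range p), m ∘ₗ p.rangeRestrict ∈ coordDual f := by
      intro m
      obtain ⟨m', hm'⟩ := LinearMap.exists_extend m
      rw [← hm']
      exact comp_invLimitProj_mem_coordDual i m'
    let ξi : Module.Dual k (Module.Dual k (LinearMap.range p)) :=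
      ξ ∘ₗ (LinearMap.lcomp k k p.rangeRestrict).codRestrict (coordDual f) hp
    have _ := hfd i
    obtain ⟨b, hb⟩ := (Module.evalEquiv k (LinearMap.range p)).surjective ξi
    exact ⟨b.1, fun m => LinearMap.congr_fun hb (m ∘ₗ (LinearMap.range p).subtype)⟩
  choose b hb using key
  have hcompat : b ∈ invLimit f := by
    intro i j h
    rw [← sub_eq_zero]
    refine (Module.forall_dual_apply_eq_zero_iff k _).1 fun m => ?_
    rw [map_sub, sub_eq_zero, hb i]
    refine (hb j (m ∘ₗ (f h : A j →ₗ[k] A i))).trans (congrArg ξ (Subtype.ext ?_))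
    ext a
    exact congrArg m (a.2 h)
  refine ⟨⟨b, hcompat⟩, ?_⟩
  let e : Module.Dual k (coordDual f) :=
    (Module.Dual.eval k (invLimit f) ⟨b, hcompat⟩).comp (coordDual f).subtype
  have hle : coordDual f ≤ (LinearMap.ker (ξ - e)).map (coordDual f).subtype := by
    refine coordDual_le fun i m => ⟨⟨_, comp_invLimitProj_mem_coordDual i m⟩, ?_, rfl⟩
    rw [SetLike.mem_coe, LinearMap.mem_ker, LinearMap.sub_apply, sub_eq_zero]
    exact (hb i m).symm
  intro l
  obtain ⟨l', hl', h⟩ := hle l.2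
  obtain rfl : l' = l := Subtype.ext h
  rw [SetLike.mem_coe, LinearMap.mem_ker, LinearMap.sub_apply, sub_eq_zero] at hl'
  exact hl'

section Topology

variable [∀ i, TopologicalSpace (A i)] [∀ i, DiscreteTopology (A i)]

theorem eventually_invLimitProj_eq (i : I) (a : invLimit f) :
    ∀ᶠ b in 𝓝 a, invLimitProj f i b = invLimitProj f i a := by
  have h : Continuous (invLimitProj f i) := (continuous_apply i).comp continuous_subtype_val
  exact h.continuousAt.eventually ((isOpen_discrete {invLimitProj f i a}).mem_nhds rfl)

theorem eventually_apply_eq_of_mem_coordDual {l : Module.Dual k (invLimit f)}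
    (hl : l ∈ coordDual f) (a : invLimit f) : ∀ᶠ b in 𝓝 a, l b = l a := by
  let S : Submodule k (Module.Dual k (invLimit f)) :=
    { carrier := {l | ∀ᶠ b in 𝓝 a, l b = l a}
      add_mem' := fun {l m} hl hm => by
        filter_upwards [hl, hm] with b h h'
        rw [LinearMap.add_apply, LinearMap.add_apply, h, h']
      zero_mem' := Filter.Eventually.of_forall fun _ => rfl
      smul_mem' := fun c l hl => by
        filter_upwards [hl] with b h
        rw [LinearMap.smul_apply, LinearMap.smul_apply, h] }
  have h : coordDual f ≤ S := coordDual_le fun i m => by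
    filter_upwards [eventually_invLimitProj_eq i a] with b hb
    exact congrArg m hb
  exact h hl

theorem eq_zero_of_mem_coordDual_of_dense {l : Module.Dual k (invLimit f)}
    (hl : l ∈ coordDual f) {S : Set (invLimit f)} (hS : Dense S) (h : ∀ a ∈ S, l a = 0) :
    l = 0 := by
  ext a
  obtain ⟨b, hb, hbS⟩ := (mem_closure_iff_frequently.1 (hS a)).and_eventually
    (eventually_apply_eq_of_mem_coordDual hl a) |>.exists
  exact hbS ▸ h b hb

end Topology

theorem comp_mulLeft_mem_coordDual [∀ i, SMulCommClass k (A i) (A i)] (a : invLimit f) {l : Module.Dual k (invLimit f)}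
    (hl : l ∈ coordDual f) : l ∘ₗ LinearMap.mulLeft k a ∈ coordDual f := by
  suffices h : coordDual f ≤ (coordDual f).comap (LinearMap.lcomp k k (LinearMap.mulLeft k a)) from
    h hl
  exact coordDual_le fun i m =>
    comp_invLimitProj_mem_coordDual i (m ∘ₗ LinearMap.mulLeft k (invLimitProj f i a))

theorem comp_mulRight_mem_coordDual [∀ i, IsScalarTower k (A i) (A i)] (a : invLimit f) {l : Module.Dual k (invLimit f)}
    (hl : l ∈ coordDual f) : l ∘ₗ LinearMap.mulRight k a ∈ coordDual f := by
  suffices h : coordDual f ≤ (coordDual f).comap (LinearMap.lcomp k k (LinearMap.mulRight k a)) from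
    h hl
  exact coordDual_le fun i m =>
    comp_invLimitProj_mem_coordDual i (m ∘ₗ LinearMap.mulRight k (invLimitProj f i a))

variable [∀ i, IsScalarTower k (A i) (A i)] [∀ i, SMulCommClass k (A i) (A i)]

variable (f) in
/-- The operators on an inverse limit whose transposes preserve `coordDual f`. -/
def continuousOps : Submonoid (Module.End k (invLimit f)) where
  carrier := {T | ∀ l ∈ coordDual f, l ∘ₗ T ∈ coordDual f}
  mul_mem' hS hT l hl := hT _ (hS l hl)
  one_mem' _ hl := hl

open scoped Pointwise in
theorem prodOps_pow_subset_continuousOps (x : ℕ → invLimit f) (n N : ℕ) :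
    prodOps k x n ^ N ⊆ continuousOps f := by
  have h1 : mulOps k x n ⊆ continuousOps f := by
    rintro _ (⟨a, -, rfl⟩ | ⟨a, -, rfl⟩)
    · exact fun l hl => comp_mulLeft_mem_coordDual a hl
    · exact fun l hl => comp_mulRight_mem_coordDual a hl
  have hpow : ∀ {S : Set (Module.End k (invLimit f))} (m : ℕ), S ⊆ continuousOps f →
      S ^ m ⊆ continuousOps f := fun _ hS => Submonoid.pow_subset hS
  refine hpow N ?_
  rintro _ ⟨S, hS, T, hT, rfl⟩
  exact mul_mem (h1 hS) (hpow n (Set.insert_subset (one_mem _) h1) hT)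

theorem mem_invLimit_variety {V : Variety k} (hAV : ∀ i, V.Mem (A i)) : V.Mem (invLimit f) := by
  intro p hp x
  refine Subtype.ext (funext fun i => ?_)
  exact (map_lift (invLimitProj f i) x p).trans (hAV i p hp _)

/-- On an inverse limit of nilpotent algebras, `1 - T` is surjective for every operator `T` that
raises degrees and preserves the kernels of the projections. -/
theorem exists_sub_apply_eq_of_isNilpotentAlg (hA : ∀ i, IsNilpotentAlg k (A i))
    {T : Module.End k (invLimit f)} (hT : T ∈ raisingOps k (invLimit f))
    (hTf : ∀ i c, invLimitProj f i c = 0 → invLimitProj f i (T c) = 0) (b : invLimit f) :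
    ∃ a, a - T a = b := by
  choose n _ hn using hA
  have hz : ∀ i m, n i ≤ m → ∀ c, invLimitProj f i ((T ^ m) c) = 0 := by
    intro i m hm c
    have h := map_mem_lowerPower (invLimitProj f i) _ (pow_apply_mem_lowerPower hT m c)
    have h' := antitone_lowerPower k (A i) (show n i ≤ m + 1 by omega) h
    rwa [hn, Submodule.mem_bot] at h'
  let s : ℕ → invLimit f := fun m => ∑ r ∈ Finset.range m, (T ^ r) b
  -- The partial sums of the geometric series `∑ T ^ r b` become constant in each coordinate, so
  -- they define a point of the limit.
  have hs : ∀ i m, n i ≤ m → invLimitProj f i (s m) = invLimitProj f i (s (n i)) := by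
    intro i m hm
    induction m, hm using Nat.le_induction with
    | base => rfl
    | succ m hm ih => rw [← ih]; simp only [s, Finset.sum_range_succ, map_add, hz i m hm, add_zero]
  have hc : (fun i => invLimitProj f i (s (n i))) ∈ invLimit f := by
    intro i j h
    change f h (invLimitProj f j (s (n j))) = invLimitProj f i (s (n i))
    rw [← hs i (max (n i) (n j)) (le_max_left _ _), ← hs j (max (n i) (n j)) (le_max_right _ _)]
    exact (s (max (n i) (n j))).2 h
  refine ⟨⟨_, hc⟩, Subtype.ext (funext fun i => ?_)⟩
  -- As `T` preserves the kernel of the projection, the limit may be replaced by a partial sum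
  -- before applying `T`.
  have h1 : invLimitProj f i (T (⟨_, hc⟩ - s (n i))) = 0 := hTf i _ (by
    rw [map_sub, sub_eq_zero]; rfl)
  have h2 : s (n i) - T (s (n i)) = b - (T ^ n i) b := by
    have h3 : T (s (n i)) = ∑ r ∈ Finset.range (n i), (T ^ (r + 1)) b := by
      simp only [s, map_sum, pow_succ', Module.End.mul_apply]
    rw [h3, ← Finset.sum_sub_distrib, Finset.sum_range_sub' fun r => (T ^ r) b]
    rfl
  rw [map_sub, map_sub, sub_eq_zero] at h1
  change invLimitProj f i (⟨_, hc⟩ - T ⟨_, hc⟩) = invLimitProj f i b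
  have h4 := congrArg (invLimitProj f i) h2
  rw [map_sub, map_sub, hz i _ le_rfl, sub_zero] at h4
  rw [map_sub, h1]
  exact h4

/-- A homomorphism from an inverse limit of nilpotent algebras to a finite-dimensional algebra
kills a lower power. -/
theorem exists_lowerPower_le_ker_of_isNilpotentAlg {B : Type*} [NonUnitalNonAssocRing B]
    [Module k B] [FiniteDimensional k B] (hA : ∀ i, IsNilpotentAlg k (A i))
    (φ : invLimit f →ₙₐ[k] B) : ∃ n, ∀ a ∈ lowerPower k (invLimit f) n, φ a = 0 := by
  refine exists_lowerPower_le_ker φ (R₀ := raisingOps k (invLimit f) ⊓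
    ⨅ i, preservingOps k (LinearMap.ker (invLimitProj f i : invLimit f →ₗ[k] A i))) inf_le_left
    (fun a => ⟨fun n b hb => mul_mem_lowerPower_succ_left k a hb, ?_⟩)
    (fun a => ⟨fun n b hb => mul_mem_lowerPower_succ_right k a hb, ?_⟩)
    (fun T hT b => exists_sub_apply_eq_of_isNilpotentAlg hA hT.1 (fun i c hc => ?_) b)
  · refine NonUnitalAlgebra.mem_iInf.2 fun i b (hb : invLimitProj f i b = 0) => ?_
    change invLimitProj f i (a * b) = 0
    rw [map_mul, hb, mul_zero]
  · refine NonUnitalAlgebra.mem_iInf.2 fun i b (hb : invLimitProj f i b = 0) => ?_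
    change invLimitProj f i (b * a) = 0
    rw [map_mul, hb, zero_mul]
  · exact NonUnitalAlgebra.mem_iInf.1 hT.2 i c hc

end Limit

end NAAlg

namespace NAAlg

open scoped Pointwise

/-! ### Openness of the lower powers and continuity. -/

section Continuity

variable {k : Type u} [Field k] {I : Type w} [Preorder I] {A : I → Type v}
  [∀ i, NonUnitalNonAssocRing (A i)] [∀ i, Module k (A i)]
  [∀ i, IsScalarTower k (A i) (A i)] [∀ i, SMulCommClass k (A i) (A i)]
  [∀ i, TopologicalSpace (A i)] [∀ i, DiscreteTopology (A i)]
  {f : ∀ ⦃i j : I⦄, i ≤ j → A j →ₙₐ[k] A i}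

/-- If an inverse limit of algebras in a separative variety, whose images in the members of the
system are finite-dimensional, has a finitely generated dense subalgebra, then its lower powers
are open. -/
theorem exists_finset_forall_mem_lowerPower {V : Variety k} (hV : V.IsSeparative)
    (hAV : ∀ i, V.Mem (A i))
    (hfd : ∀ i, FiniteDimensional k (LinearMap.range (invLimitProj f i : invLimit f →ₗ[k] A i)))
    {s : Finset (invLimit f)}
    (hs : Dense (NonUnitalAlgebra.adjoin k (s : Set (invLimit f)) : Set (invLimit f))) (N : ℕ) :
    ∃ Λ : Finset (Module.Dual k (invLimit f)), (Λ : Set (Module.Dual k (invLimit f))) ⊆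
      coordDual f ∧ ∀ a, (∀ l ∈ Λ, l a = 0) → a ∈ lowerPower k (invLimit f) (N + 1) := by
  obtain ⟨d, hd⟩ := hV
  obtain ⟨x, hx, hsx⟩ := exists_seq_finite_range_of_finset s
  have hP := finite_pow (finite_prodOps (k := k) hx (1 + d)) N
  let F := Submodule.span k (FreeMagma.lift x '' {t | t.length ≤ N * (1 + d)})
  have _ : FiniteDimensional k F :=
    FiniteDimensional.span_of_finite k (finite_image_length_le hx _)
  obtain ⟨Λ, hΛ, h⟩ := exists_finset_dual_forall_mem_iSup_range (coordDual f)
    (exists_eq_apply_of_dual_coordDual hfd) (fun a => eq_zero_of_forall_coordDual) hP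
    (fun T hT => prodOps_pow_subset_continuousOps x (1 + d) N hT) F (by
      -- Short monomials lie in `F` and long ones in the sum of ranges, so `l` vanishes on the dense
      -- subalgebra and hence everywhere.
      intro l hl hF hlP
      refine eq_zero_of_mem_coordDual_of_dense hl hs fun a ha => ?_
      suffices h : Submodule.span k (Set.range (FreeMagma.lift x)) ≤ LinearMap.ker l from
        h (mem_span_range_lift_of_mem_adjoin hsx ha)
      rw [Submodule.span_le]
      rintro _ ⟨t, rfl⟩
      rcases le_or_gt t.length (N * (1 + d)) with ht | ht
      · exact hF _ (Submodule.subset_span ⟨t, ht, rfl⟩)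
      · suffices h : ⨆ T ∈ prodOps k x (1 + d) ^ N, LinearMap.range T ≤ LinearMap.ker l from
          h (lift_mem_iSup_range hd (mem_invLimit_variety hAV) x N ht)
        refine iSup₂_le fun T hT => ?_
        rintro _ ⟨a, rfl⟩
        exact LinearMap.congr_fun (hlP T hT) a)
  exact ⟨Λ, hΛ, fun a ha => iSup_range_le_lowerPower x (1 + d) N (h a ha)⟩

/-- The image of an inverse limit in a nilpotent member of the system is finite-dimensional if the
limit has a finitely generated dense subalgebra. -/
theorem finiteDimensional_range_invLimitProj {s : Finset (invLimit f)}
    (hs : Dense (NonUnitalAlgebra.adjoin k (s : Set (invLimit f)) : Set (invLimit f))) {i : I}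
    (hi : IsNilpotentAlg k (A i)) :
    FiniteDimensional k (LinearMap.range (invLimitProj f i : invLimit f →ₗ[k] A i)) := by
  obtain ⟨n, -, hn⟩ := hi
  obtain ⟨x, hx, hsx⟩ := exists_seq_finite_range_of_finset s
  let F := (Submodule.span k (FreeMagma.lift x '' {t | t.length ≤ n})).map
    (invLimitProj f i : invLimit f →ₗ[k] A i)
  have _ : FiniteDimensional k (Submodule.span k (FreeMagma.lift x '' {t | t.length ≤ n})) :=
    FiniteDimensional.span_of_finite k (finite_image_length_le hx _)
  have _ : FiniteDimensional k F := inferInstance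
  refine Submodule.finiteDimensional_of_le (S₂ := F) ?_
  rintro _ ⟨a, rfl⟩
  -- The target is discrete, so `a` has the same image as some element of the dense subalgebra.
  -- Monomials longer than `n` map to zero, leaving finitely many values.
  obtain ⟨b, hb, hab⟩ := (mem_closure_iff_frequently.1 (hs a)).and_eventually
    (eventually_invLimitProj_eq i a) |>.exists
  change invLimitProj f i a ∈ F
  rw [← hab]
  suffices h : Submodule.span k (Set.range (FreeMagma.lift x)) ≤
      F.comap (invLimitProj f i : invLimit f →ₗ[k] A i) from
    h (mem_span_range_lift_of_mem_adjoin hsx hb)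
  rw [Submodule.span_le]
  rintro _ ⟨t, rfl⟩
  rcases le_or_gt t.length n with ht | ht
  · exact ⟨_, Submodule.subset_span ⟨t, ht, rfl⟩, rfl⟩
  · have h := antitone_lowerPower k (A i) ht.le
      (map_mem_lowerPower (invLimitProj f i) _ (lift_mem_lowerPower x t))
    rw [hn, Submodule.mem_bot] at h
    change invLimitProj f i _ ∈ F
    rw [h]
    exact zero_mem _

theorem continuous_of_forall_lowerPower {B : Type*} [NonUnitalNonAssocRing B] [Module k B]
    [TopologicalSpace B] {V : Variety k} (hV : V.IsSeparative) (hAV : ∀ i, V.Mem (A i))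
    (hfd : ∀ i, FiniteDimensional k (LinearMap.range (invLimitProj f i : invLimit f →ₗ[k] A i)))
    {s : Finset (invLimit f)}
    (hs : Dense (NonUnitalAlgebra.adjoin k (s : Set (invLimit f)) : Set (invLimit f)))
    (φ : invLimit f →ₙₐ[k] B) {n : ℕ} (hφ : ∀ a ∈ lowerPower k (invLimit f) n, φ a = 0) :
    Continuous φ := by
  obtain ⟨Λ, hΛ, h⟩ := exists_finset_forall_mem_lowerPower hV hAV hfd hs n
  refine continuous_iff_continuousAt.2 fun a => ?_
  have hev : ∀ᶠ b in 𝓝 a, φ b = φ a := by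
    filter_upwards [(Filter.eventually_all_finset Λ).2 fun l hl =>
      eventually_apply_eq_of_mem_coordDual (hΛ hl) a] with b hb
    rw [← sub_eq_zero, ← map_sub]
    refine hφ _ (lowerPower_succ_le k _ n (h _ fun l hl => ?_))
    rw [map_sub, hb l hl, sub_self]
  exact Filter.Tendsto.congr' (hev.mono fun b hb => hb.symm) tendsto_const_nhds

end Continuity

end NAAlg

theorem corollary4p2
    {k : Type*} [Field k] (V : NAAlg.Variety k) (hV : V.IsSeparative)
    -- the inverse system `(A i)` in `V`, with discrete topologies
    {I : Type*} [Preorder I] {A : I → Type*}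
    [∀ i, NonUnitalNonAssocRing (A i)] [∀ i, Module k (A i)]
    [∀ i, IsScalarTower k (A i) (A i)] [∀ i, SMulCommClass k (A i) (A i)]
    [∀ i, TopologicalSpace (A i)] [∀ i, DiscreteTopology (A i)]
    (f : ∀ ⦃i j : I⦄, i ≤ j → A j →ₙₐ[k] A i)
    (_hf : InverseSystem (fun ⦃i j : I⦄ (h : i ≤ j) => ⇑(f h)))
    (hAV : ∀ i, V.Mem (A i))
    -- the inverse system `(B j)`, with discrete topologies
    {J : Type*} [Preorder J] {B : J → Type*}
    [∀ j, NonUnitalNonAssocRing (B j)] [∀ j, Module k (B j)]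
    [∀ j, IsScalarTower k (B j) (B j)] [∀ j, SMulCommClass k (B j) (B j)]
    [∀ j, TopologicalSpace (B j)] [∀ j, DiscreteTopology (B j)]
    (g : ∀ ⦃i j : J⦄, i ≤ j → B j →ₙₐ[k] B i)
    (_hg : InverseSystem (fun ⦃i j : J⦄ (h : i ≤ j) => ⇑(g h)))
    -- `A = lim A i` has a finitely generated dense subalgebra
    (hdense : ∃ s : Finset (NAAlg.invLimit f),
      Dense (NonUnitalAlgebra.adjoin k (s : Set (NAAlg.invLimit f)) : Set (NAAlg.invLimit f)))
    (hcases :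
      ((∀ i, FiniteDimensional k (A i)) ∧ (∀ j, NAAlg.IsNilpotentAlg k (B j))) ∨
      ((∀ i, NAAlg.IsNilpotentAlg k (A i)) ∧ (∀ j, FiniteDimensional k (B j))))
    (φ : NAAlg.invLimit f →ₙₐ[k] NAAlg.invLimit g) :
    Continuous φ := by

  obtain ⟨s, hs⟩ := hdense
  have hfd : ∀ i, FiniteDimensional k
      (LinearMap.range (NAAlg.invLimitProj f i : NAAlg.invLimit f →ₗ[k] A i)) := by
    intro i
    rcases hcases with ⟨hA, -⟩ | ⟨hA, -⟩
    · have _ := hA i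
      infer_instance
    · exact NAAlg.finiteDimensional_range_invLimitProj hs (hA i)
  -- The topology of the target is induced from the product, so each coordinate can be treated
  -- separately.
  refine Continuous.subtype_mk (f := fun a => (φ a).1) (continuous_pi fun j => ?_) fun a => (φ a).2
  let ψ : NAAlg.invLimit f →ₙₐ[k] B j := (NAAlg.invLimitProj g j).comp φ
  obtain ⟨n, hn⟩ : ∃ n, ∀ a ∈ NAAlg.lowerPower k (NAAlg.invLimit f) n, ψ a = 0 := by
    rcases hcases with ⟨-, hB⟩ | ⟨hA, hB⟩
    · obtain ⟨n, -, hn⟩ := hB j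
      refine ⟨n, fun a ha => ?_⟩
      have h := NAAlg.map_mem_lowerPower ψ n ha
      rwa [hn, Submodule.mem_bot] at h
    · have _ := hB j
      exact NAAlg.exists_lowerPower_le_ker_of_isNilpotentAlg hA ψ
  exact NAAlg.continuous_of_forall_lowerPower hV hAV hfd hs ψ hn
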